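/- Let $D$ be a countable integral domain with quotient field $K$, and let $F(D)$ be the set of nonzero fractional ideals of $D$. Let $*\colon F(D)\to F(D)$, $I\mapsto I^*$, be a star operation on $D$; that is, for all $0\neq a\in K$ and all $I,J\in F(D)$: $D^*=D$ and $(aI)^*=aI^*$; $I\subseteq I^*$, and $I\subseteq J$ implies $I^*\subseteq J^*$; $(I^*)^*=I^*$. Assume that - $*$ is of finite character: for every $I\in F(D)$, $I^*=\bigcup_H H^*$, where $H$ ranges over all nonzero finitely generated fractional ideals contained in $I$; - $*$ is stable: $(I\cap J)^*=I^*\cap J^*$ for all $I,J\in F(D)$; - $D$ is $*$-sharp: whenever $I,A,B$ are nonzero (integral) ideals of $D$ with $I\supseteq AB$, there exist nonzero ideals $H,J$ of $D$ such that $I^*=(HJ)^*$, $H^*\supseteq A$ and $J^*\supseteq B$. Then $D$ is $*$-Dedekind: every $I\in F(D)$ is $*$-invertible, i.e. $(II^{-1})^*=D$, where $I^{-1}=\{x\in K\mid xI\subseteq D\}$. -/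

import Mathlib

open scoped nonZeroDivisors

/-- A star operation on a domain `D` with quotient field `K`: a map `I ↦ I^*` on the nonzero
fractional ideals of `D`. The type `FractionalIdeal D⁰ K` also contains the zero fractional ideal;
the axioms concern nonzero fractional ideals only, and the value at `0` is normalized to `0`. That
the map sends nonzero fractional ideals to nonzero ones follows from `le_star`. -/
structure StarOperation (D K : Type*) [CommRing D] [IsDomain D] [Field K] [Algebra D K]
    [IsFractionRing D K] where
  star : FractionalIdeal D⁰ K → FractionalIdeal D⁰ K
  star_zero : star 0 = 0
  star_one : star 1 = 1
  star_smul : ∀ (a : K) (I : FractionalIdeal D⁰ K), a ≠ 0 → I ≠ 0 →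
    star (FractionalIdeal.spanSingleton D⁰ a * I) = FractionalIdeal.spanSingleton D⁰ a * star I
  le_star : ∀ I : FractionalIdeal D⁰ K, I ≠ 0 → I ≤ star I
  star_mono : ∀ I J : FractionalIdeal D⁰ K, I ≠ 0 → J ≠ 0 → I ≤ J → star I ≤ star J
  star_star : ∀ I : FractionalIdeal D⁰ K, I ≠ 0 → star (star I) = star I

namespace StarOperation

variable {D K : Type*} [CommRing D] [IsDomain D] [Field K] [Algebra D K] [IsFractionRing D K]

/-- `(I ∩ J)^* = I^* ∩ J^*` for all nonzero fractional ideals. -/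
def IsStable (s : StarOperation D K) : Prop :=
  ∀ I J : FractionalIdeal D⁰ K, I ≠ 0 → J ≠ 0 → s.star (I ⊓ J) = s.star I ⊓ s.star J

/-- `I^*` is the union of the `H^*`, with `H` ranging over the nonzero finitely generated
fractional subideals of `I`. -/
def IsFiniteCharacter (s : StarOperation D K) : Prop :=
  ∀ I : FractionalIdeal D⁰ K, I ≠ 0 → ∀ x : K,
    x ∈ s.star I ↔
      ∃ H : FractionalIdeal D⁰ K, H ≠ 0 ∧ (H : Submodule D K).FG ∧ H ≤ I ∧ x ∈ s.star H

/-- `(I I⁻¹)^* = D`, where `I⁻¹ = (D : I)`. -/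
def IsInvertible (s : StarOperation D K) (I : FractionalIdeal D⁰ K) : Prop :=
  s.star (I * I⁻¹) = 1

/-- `D` is `*`-Dedekind: every nonzero fractional ideal is `*`-invertible. -/
def IsDedekind (s : StarOperation D K) : Prop :=
  ∀ I : FractionalIdeal D⁰ K, I ≠ 0 → s.IsInvertible I

/-- `D` is `*`-sharp: whenever `I ⊇ AB` with `I, A, B` nonzero integral ideals, there are nonzero
integral ideals `H, J` with `I^* = (HJ)^*`, `H^* ⊇ A` and `J^* ⊇ B`. -/
def IsSharp (s : StarOperation D K) : Prop :=
  ∀ I A B : Ideal D, I ≠ ⊥ → A ≠ ⊥ → B ≠ ⊥ → A * B ≤ I →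
    ∃ H J : Ideal D, H ≠ ⊥ ∧ J ≠ ⊥ ∧
      s.star (I : FractionalIdeal D⁰ K) = s.star ((H * J : Ideal D) : FractionalIdeal D⁰ K) ∧
      (A : FractionalIdeal D⁰ K) ≤ s.star (H : FractionalIdeal D⁰ K) ∧
      (B : FractionalIdeal D⁰ K) ≤ s.star (J : FractionalIdeal D⁰ K)

end StarOperation

/-! The `*`-closed fractional ideals form an ordered commutative monoid under the closed product,
and the claim is that its nonzero elements are units. Sharpness, applied to a unit `x ≤ A` and the
product of `A` with `x(1/A)`, yields an invertible divisorial closure of `A`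
(`exists_unit_divisorial`). Stability makes the lattice modular; with sharpness applied to `(A + B)²
⊆ A² + B`, sums of invertible ideals become invertible (`isUnit_sup`). A nonzero closed `A` that is
not invertible then contains a strictly increasing sequence of invertible ideals, obtained by
adjoining elements and bounded by the divisorial closure of `A`. By finite character the unit group
is countable, and its bounded increasing sequences have suprema. Such a sequence would yield
continuum many suprema (`not_bddAbove_range_of_strictMono_of_countable`). -/

/-! ### Countable ordered groups -/

open Classical in
/-- A countable ordered commutative group in which bounded increasing sequences have suprema has no
strictly increasing bounded sequence: otherwise the suprema of the products over subsets of a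
sufficiently sparse subsequence would be pairwise distinct. -/
theorem not_bddAbove_range_of_strictMono_of_countable {G : Type*} [CommGroup G] [PartialOrder G]
    [IsOrderedMonoid G] [Countable G]
    (hsup : ∀ a : ℕ → G, Monotone a → BddAbove (Set.range a) → ∃ x, IsLUB (Set.range a) x)
    (a : ℕ → G) (ha : StrictMono a) : ¬ BddAbove (Set.range a) := by
  intro hbdd
  obtain ⟨α, hα⟩ := hsup a ha.monotone hbdd
  -- If no such `m` existed, `α / (a (k + 1) / a k)` would be an upper bound strictly below the
  -- supremum `α`.
  have hstep : ∀ k, ∃ m, k < m ∧ ¬ a m / a k ≤ α / a m := by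
    intro k
    by_contra! hcon
    have hle : ∀ m, a m ≤ α / (a (k + 1) / a k) := by
      intro m
      have h1 : a (max m (k + 1)) / a k ≤ α / a (max m (k + 1)) := hcon _ (by omega)
      have h2 : a (k + 1) / a k ≤ α / a (max m (k + 1)) :=
        (div_le_div_right' (ha.monotone (le_max_right _ _)) _).trans h1
      rw [le_div_comm] at h2
      exact (ha.monotone (le_max_left _ _)).trans h2
    have h3 : α ≤ α / (a (k + 1) / a k) := hα.2 (by rintro _ ⟨m, rfl⟩; exact hle m)
    have h4 : a (k + 1) / a k ≤ 1 := by
      rwa [le_div_self_iff] at h3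
    rw [div_le_one'] at h4
    exact (ha (Nat.lt_succ_self k)).not_ge h4
  choose next hnext hsparse using hstep
  let φ : ℕ → ℕ := fun n => next^[n] 0
  have hφ : ∀ n, φ (n + 1) = next (φ n) := fun n => Function.iterate_succ_apply' _ _ _
  let b : ℕ → G := fun n => a (φ n)
  have hb : Monotone b := monotone_nat_of_le_succ fun n => by
    simp only [b, hφ]
    exact ha.monotone (hnext _).le
  have hbα : ∀ n, b n ≤ α := fun n => hα.1 ⟨_, rfl⟩
  have hbs : ∀ n, ¬ b (n + 1) / b n ≤ α / b (n + 1) := fun n => by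
    simp only [b, hφ]
    exact hsparse _
  let c : Set ℕ → ℕ → G := fun S n => if n ∈ S then b (n + 1) / b n else 1
  have hc1 : ∀ S n, 1 ≤ c S n := fun S n => by
    simp only [c]
    split_ifs
    · rw [one_le_div']; exact hb (Nat.le_succ n)
    · exact le_rfl
  have hc2 : ∀ S n, c S n ≤ b (n + 1) / b n := fun S n => by
    simp only [c]
    split_ifs
    · exact le_rfl
    · rw [one_le_div']; exact hb (Nat.le_succ n)
  let P : Set ℕ → ℕ → G := fun S N => ∏ i ∈ Finset.range N, c S i
  have hP : ∀ S N, P S (N + 1) = P S N * c S N := fun S N => Finset.prod_range_succ _ _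
  have hPmono : ∀ S, Monotone (P S) := fun S => monotone_nat_of_le_succ fun n => by
    rw [hP]; exact le_mul_of_one_le_right' (hc1 S n)
  have hPbd : ∀ S n N, n ≤ N → P S N ≤ P S n * (b N / b n) := by
    intro S n N hN
    induction N, hN using Nat.le_induction with
    | base => simp
    | succ N _ ih =>
      calc P S (N + 1) ≤ P S n * (b N / b n) * (b (N + 1) / b N) := by
            rw [hP]; exact mul_le_mul' ih (hc2 S N)
        _ = P S n * (b (N + 1) / b n) := by rw [mul_assoc, mul_comm (b N / b n), div_mul_div_cancel]
  -- The jumps of `b` telescope, so those from index `n` on contribute at most `α / b n`.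
  have hPα : ∀ S n N, P S N ≤ P S n * (α / b n) := by
    intro S n N
    calc P S N ≤ P S (max n N) := hPmono S (le_max_right _ _)
      _ ≤ _ := hPbd S n _ (le_max_left _ _)
      _ ≤ _ := mul_le_mul_right (div_le_div_right' (hbα _) _) _
  have hlub : ∀ S, ∃ x, IsLUB (Set.range (P S)) x := fun S =>
    hsup _ (hPmono S) ⟨_, by rintro _ ⟨N, rfl⟩; exact hPα S 0 N⟩
  choose f hf using hlub
  -- At the first difference `n`, the single jump taken by `S` is not dominated by all that `T` can
  -- still gain, by `hbs`.
  have key : ∀ S T : Set ℕ, ∀ n, n ∈ S → n ∉ T → (∀ m < n, m ∈ S ↔ m ∈ T) → f S ≠ f T := by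
    intro S T n hnS hnT hlt heq
    have hPeq : P S n = P T n := Finset.prod_congr rfl fun i hi => by
      simp only [c, hlt i (Finset.mem_range.1 hi)]
    have h1 : P T n * (b (n + 1) / b n) ≤ f S := by
      have := (hf S).1 ⟨n + 1, rfl⟩
      rwa [hP, hPeq, show c S n = b (n + 1) / b n from if_pos hnS] at this
    have h2 : f T ≤ P T n * (α / b (n + 1)) := by
      refine (hf T).2 ?_
      rintro _ ⟨N, rfl⟩
      have := hPα T (n + 1) N
      rwa [hP, show c T n = 1 from if_neg hnT, mul_one] at this
    exact hbs n (le_of_mul_le_mul_left' (h1.trans (heq ▸ h2)))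
  have hinj : Function.Injective f := by
    intro S T hST
    by_contra hne
    have hex : ∃ n, ¬ (n ∈ S ↔ n ∈ T) := by
      by_contra! h
      exact hne (Set.ext h)
    have hmin : ∀ m < Nat.find hex, m ∈ S ↔ m ∈ T := fun m hm => not_not.1 (Nat.find_min hex hm)
    have hspec := Nat.find_spec hex
    by_cases hS : Nat.find hex ∈ S
    · exact key S T _ hS (fun h => hspec ⟨fun _ => h, fun _ => hS⟩) hmin hST
    · refine key T S _ ?_ hS (fun m hm => (hmin m hm).symm) hST.symm
      by_contra h
      exact hspec ⟨fun h' => absurd h' hS, fun h' => absurd h' h⟩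
  have := hinj.countable
  obtain ⟨g, hg⟩ := exists_injective_nat (Set ℕ)
  exact Function.cantor_injective g hg

/-! ### Modularity and finite generation -/

instance FractionalIdeal.instIsModularLattice {R P : Type*} [CommRing R] [CommRing P] [Algebra R P]
    (S : Submonoid R) : IsModularLattice (FractionalIdeal S P) where
  sup_inf_le_assoc_of_le {x} y {z} h := by
    rw [← FractionalIdeal.coe_le_coe] at h ⊢
    simpa using IsModularLattice.sup_inf_le_assoc_of_le (y : Submodule R P) h

/-- A finitely generated submodule of `M * N` lies in `F * N` for a finitely generated `F ≤ M`. -/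
theorem Submodule.FG.exists_fg_le_mul {R A : Type*} [CommSemiring R] [Semiring A] [Algebra R A]
    {M N H : Submodule R A} (hH : H.FG) (hle : H ≤ M * N) :
    ∃ F : Submodule R A, F.FG ∧ F ≤ M ∧ H ≤ F * N := by
  induction H, hH using Submodule.fg_induction with
  | singleton x =>
    obtain ⟨T, T', hT, hT', hx⟩ :=
      Submodule.mem_span_mul_finite_of_mem_mul (hle (Submodule.mem_span_singleton_self x))
    refine ⟨Submodule.span R T, Submodule.fg_span T.finite_toSet, Submodule.span_le.2 hT, ?_⟩
    rw [Submodule.span_singleton_le_iff_mem]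
    rw [← Submodule.span_mul_span] at hx
    exact mul_le_mul' le_rfl (Submodule.span_le.2 hT') hx
  | sup N₁ N₂ h₁ h₂ ih₁ ih₂ =>
    obtain ⟨F₁, hF₁, hle₁, hm₁⟩ := ih₁ (le_sup_left.trans hle)
    obtain ⟨F₂, hF₂, hle₂, hm₂⟩ := ih₂ (le_sup_right.trans hle)
    refine ⟨F₁ ⊔ F₂, hF₁.sup hF₂, sup_le hle₁ hle₂, ?_⟩
    rw [Submodule.sup_mul]
    exact sup_le_sup hm₁ hm₂

/-! ### The ordered monoid of closed ideals -/

namespace StarOperation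

variable {D K : Type*} [CommRing D] [IsDomain D] [Field K] [Algebra D K] [IsFractionRing D K]
variable (s : StarOperation D K)

theorem le_star' (I : FractionalIdeal D⁰ K) : I ≤ s.star I := by
  rcases eq_or_ne I 0 with rfl | h
  · exact FractionalIdeal.zero_le _
  · exact s.le_star I h

theorem star_monotone : Monotone s.star := by
  intro I J hIJ
  rcases eq_or_ne I 0 with rfl | hI
  · rw [s.star_zero]; exact FractionalIdeal.zero_le _
  rcases eq_or_ne J 0 with rfl | hJ
  · exact absurd (FractionalIdeal.le_zero_iff.1 hIJ) hI
  · exact s.star_mono I J hI hJ hIJ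

theorem star_idem (I : FractionalIdeal D⁰ K) : s.star (s.star I) = s.star I := by
  rcases eq_or_ne I 0 with rfl | h
  · simp only [s.star_zero]
  · exact s.star_star I h

theorem mul_star_le (I J : FractionalIdeal D⁰ K) : I * s.star J ≤ s.star (I * J) := by
  rcases eq_or_ne J 0 with rfl | hJ
  · simp [s.star_zero]
  rw [FractionalIdeal.mul_le]
  intro a ha b hb
  rcases eq_or_ne a 0 with rfl | ha0
  · rw [zero_mul]; exact FractionalIdeal.zero_mem _
  have h1 : a * b ∈ FractionalIdeal.spanSingleton D⁰ a * s.star J :=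
    FractionalIdeal.mul_mem_mul (FractionalIdeal.mem_spanSingleton_self _ _) hb
  rw [← s.star_smul a J ha0 hJ] at h1
  refine s.star_monotone ?_ h1
  exact mul_le_mul_left (FractionalIdeal.spanSingleton_le_iff_mem.2 ha) _

theorem star_mul_star (I J : FractionalIdeal D⁰ K) : s.star (I * s.star J) = s.star (I * J) := by
  apply le_antisymm
  · rw [← s.star_idem (I * J)]
    exact s.star_monotone (s.mul_star_le I J)
  · exact s.star_monotone (mul_le_mul_right (s.le_star' J) _)

/-- The fractional ideals (zero included) closed under a star operation. -/
def Closed : Type _ := {I : FractionalIdeal D⁰ K // s.star I = I}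

namespace Closed

variable {s}

instance : PartialOrder s.Closed := inferInstanceAs (PartialOrder {I // s.star I = I})

variable (s) in
/-- The closure of a fractional ideal. -/
def cl (I : FractionalIdeal D⁰ K) : s.Closed := ⟨s.star I, s.star_idem I⟩

theorem cl_le_iff {I : FractionalIdeal D⁰ K} {A : s.Closed} : cl s I ≤ A ↔ I ≤ A.1 :=
  ⟨fun h => (s.le_star' I).trans h, fun h => (s.star_monotone h).trans_eq A.2⟩

theorem cl_val (A : s.Closed) : cl s A.1 = A := Subtype.ext A.2

theorem le_cl (I : FractionalIdeal D⁰ K) : I ≤ (cl s I).1 := s.le_star' I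

theorem cl_mono {I J : FractionalIdeal D⁰ K} (h : I ≤ J) : cl s I ≤ cl s J := s.star_monotone h

instance : Mul s.Closed := ⟨fun A B => cl s (A.1 * B.1)⟩

instance : One s.Closed := ⟨⟨1, s.star_one⟩⟩

theorem val_one : (1 : s.Closed).1 = 1 := rfl

theorem mul_def (A B : s.Closed) : A * B = cl s (A.1 * B.1) := rfl

theorem cl_mul_cl (I J : FractionalIdeal D⁰ K) : cl s I * cl s J = cl s (I * J) := by
  apply Subtype.ext
  change s.star (s.star I * s.star J) = s.star (I * J)
  rw [s.star_mul_star, mul_comm, s.star_mul_star, mul_comm]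

theorem cl_one : cl s 1 = 1 := Subtype.ext s.star_one

instance : CommMonoid s.Closed where
  mul_assoc A B C := by
    rw [← cl_val A, ← cl_val B, ← cl_val C]
    simp only [cl_mul_cl, mul_assoc]
  one_mul A := by rw [← cl_val A, ← cl_one, cl_mul_cl, one_mul]
  mul_one A := by rw [← cl_val A, ← cl_one, cl_mul_cl, mul_one]
  mul_comm A B := by rw [mul_def, mul_def, mul_comm]

theorem mul_le_iff {A B C : s.Closed} : A * B ≤ C ↔ A.1 * B.1 ≤ C.1 := cl_le_iff

instance : IsOrderedMonoid s.Closed where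
  mul_le_mul_left A B h C := cl_mono (mul_le_mul_left (show A.1 ≤ B.1 from h) C.1)

instance : Lattice s.Closed where
  sup A B := cl s (A.1 ⊔ B.1)
  le_sup_left A B := le_sup_left.trans (le_cl (A.1 ⊔ B.1))
  le_sup_right A B := le_sup_right.trans (le_cl (A.1 ⊔ B.1))
  sup_le _ _ _ h h' := cl_le_iff.2 (sup_le h h')
  inf A B := ⟨A.1 ⊓ B.1, le_antisymm
    (le_inf ((s.star_monotone inf_le_left).trans_eq A.2)
      ((s.star_monotone inf_le_right).trans_eq B.2)) (s.le_star' _)⟩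
  inf_le_left A _ := inf_le_left (a := A.1)
  inf_le_right A _ := inf_le_right (a := A.1)
  le_inf A B C h h' := le_inf (show A.1 ≤ B.1 from h) (show A.1 ≤ C.1 from h')

theorem cl_sup_cl (I J : FractionalIdeal D⁰ K) : cl s I ⊔ cl s J = cl s (I ⊔ J) :=
  le_antisymm (sup_le (cl_mono le_sup_left) (cl_mono le_sup_right))
    (cl_le_iff.2 (sup_le ((le_cl I).trans (le_sup_left (a := cl s I)))
      ((le_cl J).trans (le_sup_right (a := cl s I)))))

theorem mul_sup (A B C : s.Closed) : A * (B ⊔ C) = A * B ⊔ A * C := by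
  rw [← cl_val A, ← cl_val B, ← cl_val C]
  simp only [cl_mul_cl, cl_sup_cl, FractionalIdeal.sup_eq_add, mul_add]

theorem sup_mul (A B C : s.Closed) : (A ⊔ B) * C = A * C ⊔ B * C := by
  rw [mul_comm, mul_sup, mul_comm C, mul_comm C]

/-- Stability moves the meet with the closed ideal `z` inside the closure, where the modular law for
fractional ideals applies. -/
theorem isModularLattice (hstable : s.IsStable) : IsModularLattice s.Closed where
  sup_inf_le_assoc_of_le {x} y {z} h := by
    have hst : ∀ I J : FractionalIdeal D⁰ K, s.star (I ⊓ J) = s.star I ⊓ s.star J := by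
      intro I J
      rcases eq_or_ne I 0 with rfl | hI
      · rw [inf_eq_left.2 (FractionalIdeal.zero_le _), s.star_zero,
          inf_eq_left.2 (FractionalIdeal.zero_le _)]
      rcases eq_or_ne J 0 with rfl | hJ
      · rw [inf_eq_right.2 (FractionalIdeal.zero_le _), s.star_zero,
          inf_eq_right.2 (FractionalIdeal.zero_le _)]
      exact hstable I J hI hJ
    change s.star (x.1 ⊔ y.1) ⊓ z.1 ≤ s.star (x.1 ⊔ (y.1 ⊓ z.1))
    rw [← z.2, ← hst, z.2]
    exact s.star_monotone (IsModularLattice.sup_inf_le_assoc_of_le _ h)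

variable (s) in
/-- The closed fractional ideal generated by a nonzero element, as a unit. -/
noncomputable def principal (x : K) (hx : x ≠ 0) : s.Closedˣ where
  val := cl s (FractionalIdeal.spanSingleton D⁰ x)
  inv := cl s (FractionalIdeal.spanSingleton D⁰ x⁻¹)
  val_inv := by
    rw [cl_mul_cl, FractionalIdeal.spanSingleton_mul_spanSingleton, mul_inv_cancel₀ hx,
      FractionalIdeal.spanSingleton_one, cl_one]
  inv_val := by
    rw [cl_mul_cl, FractionalIdeal.spanSingleton_mul_spanSingleton, inv_mul_cancel₀ hx,
      FractionalIdeal.spanSingleton_one, cl_one]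

theorem principal_le_iff {x : K} (hx : x ≠ 0) {A : s.Closed} :
    (principal s x hx : s.Closed) ≤ A ↔ x ∈ A.1 :=
  cl_le_iff.trans FractionalIdeal.spanSingleton_le_iff_mem

theorem val_ne_zero_of_isUnit {A : s.Closed} (hA : IsUnit A) : A.1 ≠ 0 := by
  intro h
  obtain ⟨B, hB⟩ := hA.exists_right_inv
  have := congrArg Subtype.val hB
  rw [mul_def, h, zero_mul] at this
  exact zero_ne_one (s.star_zero.symm.trans this)

theorem val_ne_zero_mono {A B : s.Closed} (h : A ≤ B) (hA : A.1 ≠ 0) : B.1 ≠ 0 := fun hB =>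
  hA (FractionalIdeal.le_zero_iff.1 (hB ▸ h))

theorem exists_principal_le {A : s.Closed} (hA : A.1 ≠ 0) :
    ∃ u : s.Closedˣ, (u : s.Closed) ≤ A := by
  obtain ⟨x, hx, hx0⟩ : ∃ x ∈ A.1, x ≠ 0 := by
    by_contra! h
    exact hA (FractionalIdeal.eq_zero_iff.2 h)
  exact ⟨principal s x hx0, (principal_le_iff hx0).2 hx⟩

theorem exists_unit_mul_le_one (A : s.Closed) : ∃ u : s.Closedˣ, u * A ≤ 1 := by
  obtain ⟨a, I, ha, hI⟩ := FractionalIdeal.exists_eq_spanSingleton_mul A.1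
  have ha' : algebraMap D K a ≠ 0 := by simpa using ha
  refine ⟨principal s _ ha', ?_⟩
  change cl s (FractionalIdeal.spanSingleton D⁰ _) * A ≤ 1
  rw [← cl_val A, cl_mul_cl, cl_le_iff, hI, ← mul_assoc,
    FractionalIdeal.spanSingleton_mul_spanSingleton, mul_inv_cancel₀ ha',
    FractionalIdeal.spanSingleton_one, one_mul]
  exact FractionalIdeal.coeIdeal_le_one

/-- A residual `1 / A` exists among the closed ideals. -/
theorem exists_residual {A : s.Closed} (hA : A.1 ≠ 0) :
    ∃ R : s.Closed, ∀ Y, Y * A ≤ 1 ↔ Y ≤ R := by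
  refine ⟨cl s (1 / A.1), fun Y => ?_⟩
  rw [mul_le_iff, val_one, ← FractionalIdeal.le_div_iff_mul_le hA]
  refine ⟨fun h => h.trans (le_cl _), fun h => ?_⟩
  rw [FractionalIdeal.le_div_iff_mul_le hA]
  calc Y.1 * A.1 ≤ s.star (1 / A.1) * A.1 :=
        mul_le_mul_left (show Y.1 ≤ (cl s (1 / A.1)).1 from h) _
    _ ≤ s.star (A.1 * (1 / A.1)) := by rw [mul_comm]; exact s.mul_star_le _ _
    _ ≤ s.star 1 := s.star_monotone (by
        rw [mul_comm]; exact (FractionalIdeal.le_div_iff_mul_le hA).1 le_rfl)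
    _ = 1 := s.star_one

/-- The inverse `B` of the closure satisfies `IB ⊆ D`, so it lies in `I⁻¹`, and `(II⁻¹)^*` is
squeezed between `(IB)^*` and `D`. -/
theorem isInvertible_of_isUnit {I : FractionalIdeal D⁰ K} (h : IsUnit (cl s I)) :
    s.IsInvertible I := by
  have hI : I ≠ 0 := by
    rintro rfl
    exact val_ne_zero_of_isUnit h s.star_zero
  obtain ⟨B, hB⟩ := h.exists_right_inv
  rw [← cl_val B, cl_mul_cl] at hB
  have hB' : s.star (I * B.1) = 1 := congrArg Subtype.val hB
  have hle : B.1 ≤ I⁻¹ := by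
    rw [FractionalIdeal.inv_eq, FractionalIdeal.le_div_iff_mul_le hI, mul_comm]
    exact (s.le_star' _).trans_eq hB'
  refine le_antisymm ?_ ?_
  · rw [← s.star_one]
    refine s.star_monotone ?_
    rw [mul_comm, FractionalIdeal.inv_eq]
    exact (FractionalIdeal.le_div_iff_mul_le hI).1 le_rfl
  · rw [← hB']
    exact s.star_monotone (mul_le_mul_right hle _)

/-! ### Consequences of sharpness -/

theorem exists_mul_eq_of_isSharp (hsharp : s.IsSharp) {I A B : s.Closed} (hI : I ≤ 1) (hA : A ≤ 1)
    (hB : B ≤ 1) (hA0 : A.1 ≠ 0) (hB0 : B.1 ≠ 0) (hI0 : I.1 ≠ 0) (h : A * B ≤ I) :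
    ∃ H J : s.Closed, H ≤ 1 ∧ J ≤ 1 ∧ I = H * J ∧ A ≤ H ∧ B ≤ J := by
  obtain ⟨I', hI'⟩ := FractionalIdeal.le_one_iff_exists_coeIdeal.1 (show I.1 ≤ 1 from hI)
  obtain ⟨A', hA'⟩ := FractionalIdeal.le_one_iff_exists_coeIdeal.1 (show A.1 ≤ 1 from hA)
  obtain ⟨B', hB'⟩ := FractionalIdeal.le_one_iff_exists_coeIdeal.1 (show B.1 ≤ 1 from hB)
  rw [mul_le_iff, ← hI', ← hA', ← hB', ← FractionalIdeal.coeIdeal_mul,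
    FractionalIdeal.coeIdeal_le_coeIdeal] at h
  rw [← hI', FractionalIdeal.coeIdeal_ne_zero] at hI0
  rw [← hA', FractionalIdeal.coeIdeal_ne_zero] at hA0
  rw [← hB', FractionalIdeal.coeIdeal_ne_zero] at hB0
  obtain ⟨H, J, -, -, hHJ, hAH, hBJ⟩ := hsharp I' A' B' hI0 hA0 hB0 h
  refine ⟨cl s H, cl s J, cl_le_iff.2 FractionalIdeal.coeIdeal_le_one,
    cl_le_iff.2 FractionalIdeal.coeIdeal_le_one, ?_, ?_, ?_⟩
  · rw [cl_mul_cl, ← FractionalIdeal.coeIdeal_mul, ← cl_val I, ← hI']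
    exact Subtype.ext hHJ
  · exact hA'.symm.le.trans hAH
  · exact hB'.symm.le.trans hBJ

/-- In a sharp domain the divisorial closure of a nonzero closed ideal is invertible. -/
theorem exists_unit_divisorial (hsharp : s.IsSharp) {A : s.Closed} (hA0 : A.1 ≠ 0) :
    ∃ u : s.Closedˣ, A ≤ u ∧ ∀ Y, Y * A ≤ 1 → Y * u ≤ 1 := by
  have integral : ∀ A : s.Closed, A.1 ≠ 0 → A ≤ 1 →
      ∃ u : s.Closedˣ, A ≤ u ∧ ∀ Y, Y * A ≤ 1 → Y * u ≤ 1 := by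
    intro A hA0 hA
    obtain ⟨x, hx⟩ := exists_principal_le hA0
    obtain ⟨R, hR⟩ := exists_residual hA0
    have hRA : R * A ≤ 1 := (hR R).2 le_rfl
    have h1R : 1 ≤ R := (hR 1).1 (by rwa [one_mul])
    have hxR : x * R ≤ 1 := calc
      x * R ≤ A * R := mul_le_mul_left hx R
      _ ≤ 1 := by rwa [mul_comm]
    have hx0 := val_ne_zero_of_isUnit x.isUnit
    have hxxR : (x : s.Closed) ≤ x * R := le_mul_of_one_le_right' h1R
    -- The factor `H` of the unit `x = HJ` is invertible. Since `xR ≤ J`, any `Y ≤ R` satisfies `xYH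
    -- ≤ JH = x`.
    obtain ⟨H, J, -, -, hHJ, hAH, hRJ⟩ := exists_mul_eq_of_isSharp hsharp
      (I := (x : s.Closed)) (A := A) (B := x * R) (hx.trans hA) hA hxR hA0 (val_ne_zero_mono hxxR hx0) hx0 (by
        calc A * (x * R) = x * (R * A) := by rw [mul_left_comm, mul_comm A]
          _ ≤ x := mul_le_of_le_one_right' hRA)
    have hH : IsUnit H := isUnit_of_mul_isUnit_left (hHJ ▸ x.isUnit)
    refine ⟨hH.unit, hAH, fun Y hY => ?_⟩
    have h1 : x * (Y * H) ≤ x * 1 := calc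
      x * (Y * H) = (x * Y) * H := by rw [mul_assoc]
      _ ≤ (x * R) * H := mul_le_mul_left (mul_le_mul_right ((hR Y).1 hY) _) _
      _ ≤ J * H := mul_le_mul_left hRJ _
      _ = x * 1 := by rw [mul_comm, ← hHJ, mul_one]
    exact x.mulLECancellable_val h1
  obtain ⟨v, hv⟩ := exists_unit_mul_le_one A
  have hvA0 : (v * A : s.Closed).1 ≠ 0 := by
    obtain ⟨x, hx⟩ := exists_principal_le hA0
    exact val_ne_zero_mono (mul_le_mul_right hx (v : s.Closed))
      (val_ne_zero_of_isUnit (v * x).isUnit)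
  obtain ⟨u, hu, hY⟩ := integral _ hvA0 hv
  refine ⟨v⁻¹ * u, ?_, fun Y h => ?_⟩
  · rw [Units.val_mul, Units.le_inv_mul_iff]
    exact hu
  · have := hY (Y * ↑v⁻¹) (by rwa [mul_assoc, Units.inv_mul_cancel_left])
    rwa [Units.val_mul, ← mul_assoc]

/-- Invertible integral ideals `A`, `B` of a sharp domain with `A ∩ B ⊆ AB` are comaximal. -/
theorem sup_eq_one_of_inf_le_mul (hstable : s.IsStable) (hsharp : s.IsSharp) (a b : s.Closedˣ)
    (ha : (a : s.Closed) ≤ 1) (hb : (b : s.Closed) ≤ 1) (hab : (a ⊓ b : s.Closed) ≤ a * b) :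
    (a ⊔ b : s.Closed) = 1 := by
  have := isModularLattice hstable
  have ha0 := val_ne_zero_of_isUnit a.isUnit
  have hb0 := val_ne_zero_of_isUnit b.isUnit
  set A : s.Closed := a.val
  set B : s.Closed := b.val
  have hAA : A * A ≤ A := mul_le_of_le_one_right' ha
  have hBB : B * B ≤ B := mul_le_of_le_one_right' hb
  have hAB : A * B ≤ B := mul_le_of_le_one_left' ha
  have hAB' : A * B ≤ A := mul_le_of_le_one_right' hb
  have hsq : (A ⊔ B) * (A ⊔ B) ≤ A * A ⊔ B := by
    rw [sup_mul, mul_sup, mul_sup, mul_comm B A]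
    exact sup_le (sup_le le_sup_left (hAB.trans le_sup_right))
      (sup_le (hAB.trans le_sup_right) (hBB.trans le_sup_right))
  have hsum0 : (A ⊔ B).1 ≠ 0 := val_ne_zero_mono le_sup_left ha0
  obtain ⟨H, J, hH1, hJ1, hHJ, hH, hJ⟩ := exists_mul_eq_of_isSharp hsharp
    (sup_le (hAA.trans ha) hb) (sup_le ha hb) (sup_le ha hb) hsum0 hsum0
    (val_ne_zero_mono le_sup_right hb0) hsq
  -- Meet with `A`, apply the modular law and `A ⊓ B ≤ AB`, then cancel the unit `A`.
  have bound : ∀ X, X ≤ 1 → A * X ≤ A * A ⊔ B → X ≤ A ⊔ B := by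
    intro X hX h
    apply a.mulLECancellable_val
    calc A * X ≤ (A * A ⊔ B) ⊓ A := le_inf h (mul_le_of_le_one_right' hX)
      _ ≤ A * A ⊔ (B ⊓ A) := IsModularLattice.sup_inf_le_assoc_of_le _ hAA
      _ ≤ A * A ⊔ A * B := sup_le_sup_left (by rwa [inf_comm]) _
      _ = A * (A ⊔ B) := (mul_sup _ _ _).symm
  have hH' : H ≤ A ⊔ B := bound H hH1 (by
    rw [mul_comm, hHJ]; exact mul_le_mul_right (le_sup_left.trans hJ) _)
  have hJ' : J ≤ A ⊔ B := bound J hJ1 (by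
    rw [hHJ]; exact mul_le_mul_left (le_sup_left.trans hH) _)
  -- Both factors lie in `A ⊔ B`, so `B ≤ (A ⊔ B)²`; a second use of the modular law then allows `B`
  -- to be cancelled.
  have hB : B ≤ A ⊔ B * B := calc
    B ≤ H * J := hHJ ▸ le_sup_right
    _ ≤ (A ⊔ B) * (A ⊔ B) := mul_le_mul' hH' hJ'
    _ ≤ A ⊔ B * B := by
      rw [sup_mul, mul_sup, mul_sup, mul_comm B A]
      exact sup_le (sup_le (hAA.trans le_sup_left) (hAB'.trans le_sup_left))
        (sup_le (hAB'.trans le_sup_left) le_sup_right)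
  refine le_antisymm (sup_le ha hb) (b.mulLECancellable_val ?_)
  calc B * 1 ≤ (B * B ⊔ A) ⊓ B := by
        rw [mul_one, sup_comm]; exact le_inf hB le_rfl
    _ ≤ B * B ⊔ (A ⊓ B) := IsModularLattice.sup_inf_le_assoc_of_le _ hBB
    _ ≤ B * B ⊔ B * A := sup_le_sup_left (by rwa [mul_comm]) _
    _ = B * (A ⊔ B) := by rw [mul_sup, sup_comm]

/-- In a sharp domain the sum of two invertible closed ideals is invertible. -/
theorem isUnit_sup (hstable : s.IsStable) (hsharp : s.IsSharp) (a b : s.Closedˣ) :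
    IsUnit (a ⊔ b : s.Closed) := by
  obtain ⟨u, hu, hY⟩ := exists_unit_divisorial hsharp
    (val_ne_zero_mono (le_sup_left : a.val ≤ a.val ⊔ b.val) (val_ne_zero_of_isUnit a.isUnit))
  -- After division by `u` the sum has trivial divisorial closure. Since `(p ⊓ q)p⁻¹q⁻¹` multiplies
  -- `p ⊔ q` into `1`, it is itself at most `1`, which gives `p ⊓ q ≤ pq`.
  have key : ((a * u⁻¹ : s.Closedˣ) ⊔ (b * u⁻¹ : s.Closedˣ) : s.Closed) = 1 := by
    apply sup_eq_one_of_inf_le_mul hstable hsharp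
    · rw [Units.val_mul, ← u.mul_inv]
      exact mul_le_mul_left (le_sup_left.trans hu) _
    · rw [Units.val_mul, ← u.mul_inv]
      exact mul_le_mul_left (le_sup_right.trans hu) _
    · set p := a * u⁻¹
      set q := b * u⁻¹
      set X : s.Closed := p.val ⊓ q.val
      have hsum : X * (p⁻¹ * q⁻¹ : s.Closedˣ) * (p.val ⊔ q.val) ≤ 1 := by
        rw [mul_sup]
        refine sup_le ?_ ?_
        · calc X * (p⁻¹ * q⁻¹ : s.Closedˣ) * p = X * (p⁻¹ * q⁻¹ * p : s.Closedˣ) := by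
                rw [mul_assoc, ← Units.val_mul]
            _ = X * (q⁻¹ : s.Closedˣ) := by rw [mul_comm p⁻¹, inv_mul_cancel_right]
            _ ≤ q * (q⁻¹ : s.Closedˣ) := mul_le_mul_left inf_le_right _
            _ = 1 := q.mul_inv
        · calc X * (p⁻¹ * q⁻¹ : s.Closedˣ) * q = X * (p⁻¹ * q⁻¹ * q : s.Closedˣ) := by
                rw [mul_assoc, ← Units.val_mul]
            _ = X * (p⁻¹ : s.Closedˣ) := by rw [inv_mul_cancel_right]
            _ ≤ p * (p⁻¹ : s.Closedˣ) := mul_le_mul_left inf_le_left _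
            _ = 1 := p.mul_inv
      have hpq : (p ⊔ q : s.Closed) = (a.val ⊔ b.val) * (u⁻¹ : s.Closedˣ) := by
        rw [sup_mul, ← Units.val_mul, ← Units.val_mul]
      have h1 : X * (p⁻¹ * q⁻¹ : s.Closedˣ) ≤ 1 := by
        rw [hpq, mul_comm (a ⊔ b : s.Closed), ← mul_assoc] at hsum
        have := hY _ hsum
        rwa [mul_assoc, u.inv_mul, mul_one] at this
      calc X = X * (p⁻¹ * q⁻¹ : s.Closedˣ) * (p * q : s.Closedˣ) := by
            rw [mul_assoc, ← Units.val_mul, ← mul_inv, inv_mul_cancel, Units.val_one, mul_one]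
        _ ≤ 1 * (p * q : s.Closedˣ) := mul_le_mul_left h1 _
        _ = p * q := by rw [one_mul, Units.val_mul]
  have : (a ⊔ b : s.Closed) = u := by
    calc (a ⊔ b : s.Closed) = (a.val ⊔ b.val) * (u⁻¹ : s.Closedˣ) * u := by
          rw [mul_assoc, u.inv_mul, mul_one]
      _ = u := by rw [sup_mul, ← Units.val_mul, ← Units.val_mul, key, one_mul]
  exact this ▸ u.isUnit

/-! ### Finite character and countability -/

/-- For a star operation of finite character every invertible closed ideal is the closure of a
finitely generated ideal. -/
theorem exists_fg_of_isUnit (hfin : s.IsFiniteCharacter) {A : s.Closed} (hA : IsUnit A) :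
    ∃ F : FractionalIdeal D⁰ K, (F : Submodule D K).FG ∧ A = cl s F := by
  obtain ⟨B, hB⟩ := hA.exists_right_inv
  have hstar : s.star (A.1 * B.1) = 1 := congrArg Subtype.val hB
  have h0 : A.1 * B.1 ≠ 0 := by
    intro h
    rw [h, s.star_zero] at hstar
    exact zero_ne_one hstar
  -- Finite character puts `1` in the closure of a finitely generated `H ≤ AB`, and `H` uses only a
  -- finitely generated part `F` of `A`.
  obtain ⟨H, -, hHfg, hHle, hH⟩ := (hfin _ h0 1).1 (hstar ▸ FractionalIdeal.one_mem_one D⁰)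
  rw [← FractionalIdeal.coe_le_coe, FractionalIdeal.coe_mul] at hHle
  obtain ⟨F, hF, hFA, hHF⟩ := hHfg.exists_fg_le_mul hHle
  let F' : FractionalIdeal D⁰ K := ⟨F, FractionalIdeal.isFractional_of_le hFA⟩
  have hF'A : F' ≤ A.1 := hFA
  have hHF' : H ≤ F' * B.1 := by
    rw [← FractionalIdeal.coe_le_coe, FractionalIdeal.coe_mul]
    exact hHF
  refine ⟨F', hF, le_antisymm ?_ (cl_le_iff.2 hF'A)⟩
  have h1 : 1 ≤ cl s F' * B := by
    change (1 : FractionalIdeal D⁰ K) ≤ (cl s F' * B).1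
    rw [FractionalIdeal.one_le, ← cl_val B, cl_mul_cl]
    exact s.star_monotone hHF' hH
  calc A = 1 * A := (one_mul A).symm
    _ ≤ cl s F' * B * A := mul_le_mul_left h1 A
    _ = cl s F' := by rw [mul_assoc, mul_comm B, hB, mul_one]

/-- A unit is determined by a finite subset of the countable field `K` that generates it up to
closure. -/
theorem countable_units [Countable D] (hfin : s.IsFiniteCharacter) : Countable s.Closedˣ := by
  have : Countable K :=
    Function.Surjective.countable (f := fun p : D × D⁰ => IsLocalization.mk' K p.1 p.2)
      (fun x => by
        obtain ⟨a, b, h⟩ := IsLocalization.exists_mk'_eq D⁰ x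
        exact ⟨(a, b), h⟩)
  have hex : ∀ u : s.Closedˣ, ∃ t : Finset K, ∃ F : FractionalIdeal D⁰ K,
      Submodule.span D (t : Set K) = F ∧ (u : s.Closed) = cl s F := fun u => by
    obtain ⟨F, ⟨t, ht⟩, hu⟩ := exists_fg_of_isUnit hfin u.isUnit
    exact ⟨t, F, ht, hu⟩
  choose t F hF hu using hex
  refine Function.Injective.countable (f := t) fun u v huv => Units.ext ?_
  rw [hu, hu, FractionalIdeal.coeToSubmodule_injective ((hF u).symm.trans (huv ▸ hF v))]

/-- The supremum is the divisorial closure of the sum of the ideals, which is fractional because of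
the bound. It lies below every unit bound `v`, because `v⁻¹` multiplies the sum into `1`. -/
theorem exists_isLUB_units (hsharp : s.IsSharp) (a : ℕ → s.Closedˣ)
    (hbdd : BddAbove (Set.range a)) : ∃ x, IsLUB (Set.range a) x := by
  obtain ⟨w, hw⟩ := hbdd
  have hle : ∀ v : s.Closedˣ, v ∈ upperBounds (Set.range a) →
      (⨆ n, ((a n).val.1 : Submodule D K)) ≤ v.val.1 := fun v hv =>
    iSup_le fun n => FractionalIdeal.coe_le_coe.2 (show (a n).val ≤ v.val from hv ⟨n, rfl⟩)
  let I : FractionalIdeal D⁰ K := ⟨_, FractionalIdeal.isFractional_of_le (hle w hw)⟩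
  have haI : ∀ n, (a n).val ≤ cl s I := fun n =>
    le_trans (b := I) (FractionalIdeal.coe_le_coe.1
      (le_iSup (fun n => ((a n).val.1 : Submodule D K)) n)) (le_cl I)
  obtain ⟨u, hu, hY⟩ := exists_unit_divisorial hsharp
    (val_ne_zero_mono (haI 0) (val_ne_zero_of_isUnit (a 0).isUnit))
  refine ⟨u, ?_, fun v hv => ?_⟩
  · rintro _ ⟨n, rfl⟩
    exact (haI n).trans hu
  · have hIv : cl s I ≤ v := cl_le_iff.2 (hle v hv)
    have := hY (v⁻¹ : s.Closedˣ) ((mul_le_mul_right hIv _).trans_eq v.inv_mul)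
    rw [Units.inv_mul_le_iff, mul_one] at this
    exact this

theorem isUnit_of_countable [Countable D] (hfin : s.IsFiniteCharacter) (hstable : s.IsStable)
    (hsharp : s.IsSharp) {A : s.Closed} (hA : A.1 ≠ 0) : IsUnit A := by
  by_contra hunit
  -- Adjoining to `u` an element of `A` outside it gives a strictly larger invertible ideal, still
  -- inside `A`.
  have hstep : ∀ u : {u : s.Closedˣ // u.val ≤ A}, ∃ v : {u : s.Closedˣ // u.val ≤ A}, u < v := by
    rintro ⟨u, hu⟩
    obtain ⟨x, hxA, hxu⟩ : ∃ x ∈ A.1, x ∉ u.val.1 := by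
      by_contra! h
      exact hunit (le_antisymm hu h ▸ u.isUnit)
    have hx0 : x ≠ 0 := by
      rintro rfl
      exact hxu (FractionalIdeal.zero_mem _)
    have hv := isUnit_sup hstable hsharp u (principal s x hx0)
    refine ⟨⟨hv.unit, sup_le hu ((principal_le_iff hx0).2 hxA)⟩, lt_of_le_not_ge ?_ fun h => hxu ?_⟩
    · exact (le_sup_left : u.val ≤ _)
    · exact (principal_le_iff hx0).1 (le_trans le_sup_right (show hv.unit.val ≤ u.val from h))
  choose next hnext using hstep
  obtain ⟨u₀, hu₀⟩ := exists_principal_le hA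
  obtain ⟨w, hw, -⟩ := exists_unit_divisorial hsharp hA
  let a : ℕ → {u : s.Closedˣ // u.val ≤ A} := fun n => next^[n] ⟨u₀, hu₀⟩
  have ha : StrictMono a := strictMono_nat_of_lt_succ fun n => by
    simp only [a, Function.iterate_succ_apply']
    exact hnext _
  have := countable_units hfin
  refine not_bddAbove_range_of_strictMono_of_countable
    (fun a _ => exists_isLUB_units hsharp a) (fun n => (a n).1) (fun m n h => ha h) ⟨w, ?_⟩
  rintro _ ⟨n, rfl⟩
  exact (a n).2.trans hw

end Closed
end StarOperation

theorem mainTheorem6 {D K : Type*} [CommRing D] [IsDomain D] [Countable D]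
    [Field K] [Algebra D K] [IsFractionRing D K]
    (s : StarOperation D K) (hfin : s.IsFiniteCharacter) (hstable : s.IsStable)
    (hsharp : s.IsSharp) :
    s.IsDedekind := by
  intro I hI
  refine StarOperation.Closed.isInvertible_of_isUnit
    (StarOperation.Closed.isUnit_of_countable hfin hstable hsharp fun h => hI ?_)
  exact FractionalIdeal.le_zero_iff.1 ((StarOperation.Closed.le_cl I).trans_eq h)
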